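/- Let $\mathbb N=\{1,2,3,\dots\}$, let $\mathcal P_f(X)$ denote the set of all nonempty finite subsets of a set $X$, and let $\tau={}^{\mathbb N}\mathbb N$ be the set of all sequences $f:\mathbb N\to\mathbb N$. For $\beta,\gamma\in\mathcal P_f(\mathbb N)$ write $\beta<\gamma$ if $\max\beta<\min\gamma$. Let $\beta\mathbb N$ be the set of ultrafilters on $\mathbb N$, with the operation given by $A\in p+q$ if and only if $\{x\in\mathbb N:\{y\in\mathbb N:x+y\in A\}\in q\}\in p$; an ultrafilter $p$ is idempotent if $p+p=p$. A set $A\subseteq\mathbb N$ is a $J$-set if for every $F\in\mathcal P_f(\tau)$ there exist $a\in\mathbb N$ and $\beta\in\mathcal P_f(\mathbb N)$ such that $a+\sum_{t\in\beta}f(t)\in A$ for all $f\in F$. Let $\mathcal J$ be the set of all $p\in\beta\mathbb N$ such that every member of $p$ is a $J$-set. For $p\in\beta\mathbb N$, the ultrafilter $\bigotimes_{i=1}^m p$ on $\mathbb N^m$ is defined recursively: $\bigotimes_{i=1}^1p=p$, and for $k\ge1$ and $B\subseteq\mathbb N^{k+1}$, $B\in\bigotimes_{i=1}^{k+1}p$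 if and only if $$\{(x_1,\dots,x_k)\in\mathbb N^k:\{x_{k+1}\in\mathbb N:(x_1,\dots,x_{k+1})\in B\}\in p\}\in\bigotimes_{i=1}^{k}p.$$ **Corollary.** Let $m\in\mathbb N$ and $A\subseteq\mathbb N^m$. The following two statements are equivalent. 1. There exist functions $\alpha:\mathcal P_f(\tau)\to\mathbb N$ and $H:\mathcal P_f(\tau)\to\mathcal P_f(\mathbb N)$ such that - (a) if $F,G\in\mathcal P_f(\tau)$ and $F\subsetneq G$, then $\max H(F)<\min H(G)$; and - (b) whenever $(G_i)_{i\in\mathbb N}$ is a sequence in $\mathcal P_f(\tau)$ with $G_1\subsetneq G_2\subsetneq\cdots\subsetneq G_n\subsetneq\cdots$, then for all $\beta_1<\beta_2<\cdots<\beta_m$ in $\mathcal P_f(\mathbb N)$ and all choices of $f_i\in G_i$ $(i\in\mathbb N)$, $$\left(\sum_{i\in\beta_1}\Bigl(\alpha(G_i)+\sum_{t\in H(G_i)}f_i(t)\Bigr),\ \dots,\ \sum_{i\in\beta_m}\Bigl(\alpha(G_i)+\sum_{t\in H(G_i)}f_i(t)\Bigr)\right)\in A.$$ 2. There exists an idempotent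 $p\in\mathcal J$ such that $A\in\bigotimes_{i=1}^m p$. -/

import Mathlib

/-- `PFin X` is the collection of all nonempty finite subsets of `X`. -/
abbrev PFin (X : Type*) : Type _ := {s : Finset X // s.Nonempty}

/-- `s.Precedes t` means `max s < min t`. -/
def PFin.Precedes (s t : PFin ℕ+) : Prop := s.1.max' s.2 < t.1.min' t.2

/-- The sum `∑ t ∈ s, f t` of positive integers over a nonempty finite set, again a positive
integer. It is computed in `ℕ`, because `ℕ+` has no zero. -/
def PFin.sum {ι : Type*} (s : PFin ι) (f : ι → ℕ+) : ℕ+ :=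
  ⟨∑ t ∈ s.1, (f t : ℕ), Finset.sum_pos (fun t _ => (f t).pos) s.2⟩

/-- `A` is a `J`-set: for every nonempty finite set `F` of sequences of positive integers there
are `a` and a nonempty finite `β` with `a + ∑ t ∈ β, f t ∈ A` for all `f ∈ F`. -/
def IsJSet (A : Set ℕ+) : Prop :=
  ∀ F : PFin (ℕ+ → ℕ+), ∃ (a : ℕ+) (β : PFin ℕ+), ∀ f ∈ F.1, a + β.sum f ∈ A

/-- The set `𝒥` of all ultrafilters on the positive integers all of whose members are `J`-sets. -/
def JUltrafilters : Set (Ultrafilter ℕ+) := {p | ∀ A ∈ p, IsJSet A}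

/-- The tensor product `p₁ ⊗ ⋯ ⊗ pₖ` of ultrafilters on `S`, an ultrafilter on `Sᵏ`. The empty
product is the principal ultrafilter at the only point of `S⁰`. -/
noncomputable def ultrafilterTensor {S : Type*} :
    (k : ℕ) → (Fin k → Ultrafilter S) → Ultrafilter (Fin k → S)
  | 0, _ => pure Fin.elim0
  | k + 1, p =>
    (ultrafilterTensor k (fun i => p i.castSucc)).bind fun x =>
      (p (Fin.last k)).map fun y => Fin.snoc (α := fun _ => S) x y

/-- The recursive membership rule of the tensor product. -/
theorem mem_ultrafilterTensor_succ {S : Type*} (k : ℕ) (p : Fin (k + 1) → Ultrafilter S)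
    (A : Set (Fin (k + 1) → S)) :
    A ∈ ultrafilterTensor (k + 1) p ↔
      {x : Fin k → S | {y : S | Fin.snoc (α := fun _ => S) x y ∈ A} ∈ p (Fin.last k)} ∈
        ultrafilterTensor k (fun i => p i.castSucc) :=
  Iff.rfl

/-- The tensor product of a single ultrafilter is that ultrafilter, with `S¹` identified
with `S`. -/
theorem mem_ultrafilterTensor_one {S : Type*} (p : Fin 1 → Ultrafilter S)
    (A : Set (Fin 1 → S)) :
    A ∈ ultrafilterTensor 1 p ↔ {y : S | (fun _ => y) ∈ A} ∈ p 0 := by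
  rw [mem_ultrafilterTensor_succ]
  change {y : S | Fin.snoc (α := fun _ => S) Fin.elim0 y ∈ A} ∈ p (Fin.last 0) ↔ _
  have h : ∀ y : S, Fin.snoc (α := fun _ => S) Fin.elim0 y = (fun _ : Fin 1 => y) := by
    intro y
    funext i
    have hi : i = Fin.last 0 := Fin.ext (by omega)
    rw [hi, Fin.snoc_last]
  simp only [h]
  rfl

attribute [local instance] Ultrafilter.add

/-- The extension of addition to ultrafilters: `A ∈ p + q` if and only if
`{x | -x + A ∈ q} ∈ p`. -/
theorem mem_ultrafilter_add (p q : Ultrafilter ℕ+) (A : Set ℕ+) :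
    A ∈ p + q ↔ {x : ℕ+ | {y : ℕ+ | x + y ∈ A} ∈ q} ∈ p :=
  Ultrafilter.eventually_add p q (· ∈ A)

/-! From (2) to (1): membership of `A` in the tensor power unfolds into a tree of sets in `p`, and
idempotence allows each node to be shrunk so that its translates by its own members stay in `p`.
Then `α F` and `H F` are chosen by recursion on the finite set `F`. Proper subsets of `F` have
produced only finitely many partial block sums, so the next term is only required to lie in a finite
intersection of members of `p`. That intersection is a `J`-set and serves all `f ∈ F` at once
(`exists_chain_functions`).

From (1) to (2): the sums along finite chains above `F` form a `J`-set that decreases as `F` grows.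
Since `J`-sets are partition regular (`IsJSet.of_union`, by Hales–Jewett), some `p ∈ 𝒥` contains all
these sets. Such `p` form a compact subsemigroup, which has an idempotent. For it, almost every `x₁`
is a chain sum ending in some `G`, almost every `x₂` is a chain sum above `G`, and so on, so almost
every tuple consists of block sums along one chain (`isBlockSums_mem_tensor`). -/

theorem PFin.coe_sum {ι : Type*} (s : PFin ι) (f : ι → ℕ+) :
    ((s.sum f : ℕ+) : ℕ) = ∑ t ∈ s.1, (f t : ℕ) := rfl

theorem PFin.precedes_iff {s t : PFin ℕ+} :
    s.Precedes t ↔ ∀ a ∈ s.1, ∀ b ∈ t.1, a < b := by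
  unfold PFin.Precedes
  constructor
  · intro h a ha b hb
    exact (Finset.le_max' _ a ha).trans_lt (h.trans_le (Finset.min'_le _ b hb))
  · intro h
    exact h _ (Finset.max'_mem _ _) _ (Finset.min'_mem _ _)

/-! ### `J`-sets and the ultrafilters in `𝒥` -/

theorem IsJSet.mono {A B : Set ℕ+} (hA : IsJSet A) (h : A ⊆ B) : IsJSet B := by
  intro F
  obtain ⟨a, β, hβ⟩ := hA F
  exact ⟨a, β, fun f hf => h (hβ f hf)⟩

/-- In a `J`-set the index set can be chosen beyond any given bound. -/
theorem IsJSet.exists_gt {A : Set ℕ+} (hA : IsJSet A) (F : PFin (ℕ+ → ℕ+)) (N : ℕ+) :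
    ∃ (a : ℕ+) (β : PFin ℕ+), (∀ t ∈ β.1, N < t) ∧ ∀ f ∈ F.1, a + β.sum f ∈ A := by
  classical
  -- Shifting every sequence by `N` moves the index set beyond `N`.
  obtain ⟨a, β, h⟩ := hA ⟨F.1.image fun f t => f (t + N), F.2.image _⟩
  refine ⟨a, ⟨β.1.map (addRightEmbedding N), β.2.map⟩, ?_, fun f hf => ?_⟩
  · intro t ht
    obtain ⟨u, -, rfl⟩ := Finset.mem_map.1 ht
    exact PNat.lt_add_left N u
  · have h1 := h _ (Finset.mem_image_of_mem _ hf)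
    convert h1 using 2
    apply PNat.coe_injective
    simp [PFin.coe_sum]

/-- `J`-sets are partition regular. -/
theorem IsJSet.of_union {A B : Set ℕ+} (h : IsJSet (A ∪ B)) : IsJSet A ∨ IsJSet B := by
  classical
  by_contra! hAB
  obtain ⟨hA, hB⟩ := hAB
  unfold IsJSet at hA hB
  push Not at hA hB
  obtain ⟨F₁, hF₁⟩ := hA
  obtain ⟨F₂, hF₂⟩ := hB
  -- Hales–Jewett with the sequences of both counterexamples as letters and two colours, for "in
  -- `A`" and "not in `A`".
  obtain ⟨ι, _, hι⟩ := Combinatorics.Line.exists_mono_in_high_dimension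
    (↥(F₁.1 ∪ F₂.1)) Bool
  have : Nonempty ι := by
    obtain ⟨l, -⟩ := hι fun _ => true
    exact ⟨l.proper.choose⟩
  obtain ⟨e, he⟩ := exists_injective_nat (ℕ+ × ι)
  let pos : ℕ+ × ι → ℕ+ := fun x => (e x).succPNat
  have hpos : Function.Injective pos := Nat.succPNat_injective.comp he
  -- A word becomes one sequence: term `y` adds up the letters of the word, each read at its own
  -- position `pos (y, i)`. Injectivity of `pos` keeps the positions distinct.
  let g : (ι → ↥(F₁.1 ∪ F₂.1)) → ℕ+ → ℕ+ := fun w y =>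
    PFin.sum ⟨Finset.univ, Finset.univ_nonempty⟩ fun i => (w i : ℕ+ → ℕ+) (pos (y, i))
  obtain ⟨f₀, hf₀⟩ := F₁.2
  have : Nonempty ↥(F₁.1 ∪ F₂.1) := ⟨⟨f₀, Finset.mem_union_left _ hf₀⟩⟩
  obtain ⟨a, β, hβ⟩ := h ⟨Finset.univ.image g, Finset.univ_nonempty.image _⟩
  obtain ⟨l, c, hl⟩ := hι fun w => decide (a + β.sum (g w) ∈ A)
  let K : Finset ι := Finset.univ.filter fun i => l.idxFun i = none
  have hK : K.Nonempty := by
    obtain ⟨i, hi⟩ := l.proper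
    exact ⟨i, by simp [K, hi]⟩
  let β' : PFin ℕ+ := ⟨(β.1 ×ˢ K).map ⟨pos, hpos⟩, (β.2.product hK).map⟩
  let x₀ : ↥(F₁.1 ∪ F₂.1) := Classical.arbitrary _
  -- The fixed coordinates of the line contribute the same amount for every letter, so they are
  -- absorbed into the constant; `x₀` is arbitrary.
  let a' : ℕ+ := ⟨a + ∑ t ∈ β.1, ∑ i ∈ Finset.univ.filter (fun i => ¬ l.idxFun i = none),
    ((l x₀ i : ℕ+ → ℕ+) (pos (t, i)) : ℕ), by have := a.pos; omega⟩
  have key : ∀ x : ↥(F₁.1 ∪ F₂.1), a + β.sum (g (l x)) = a' + β'.sum x.1 := by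
    intro x
    apply PNat.coe_injective
    have e₁ : (a' : ℕ) = a + ∑ t ∈ β.1,
        ∑ i ∈ Finset.univ.filter (fun i => ¬ l.idxFun i = none),
          ((l x₀ i : ℕ+ → ℕ+) (pos (t, i)) : ℕ) := rfl
    have e₂ : (β'.sum x.1 : ℕ) = ∑ t ∈ β.1, ∑ i ∈ K, (x.1 (pos (t, i)) : ℕ) := by
      rw [PFin.coe_sum]
      simp only [β', Finset.sum_map, Finset.sum_product, Function.Embedding.coeFn_mk]
    have e₃ : (β.sum (g (l x)) : ℕ) =
        ∑ t ∈ β.1, ∑ i, ((l x i : ℕ+ → ℕ+) (pos (t, i)) : ℕ) := rfl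
    rw [PNat.add_coe, PNat.add_coe, e₁, e₂, e₃, add_assoc, ← Finset.sum_add_distrib]
    congr 1
    refine Finset.sum_congr rfl fun t _ => ?_
    rw [← Finset.sum_filter_add_sum_filter_not _ (fun i => l.idxFun i = none), add_comm]
    congr 1
    · refine Finset.sum_congr rfl fun i hi => ?_
      obtain ⟨y, hy⟩ := Option.ne_none_iff_exists'.1 (Finset.mem_filter.1 hi).2
      simp [Combinatorics.Line.coe_apply, hy]
    · refine Finset.sum_congr rfl fun i hi => ?_
      simp [Combinatorics.Line.coe_apply, (Finset.mem_filter.1 hi).2]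
  have hmem : ∀ x : ↥(F₁.1 ∪ F₂.1), a' + β'.sum x.1 ∈ A ∪ B := fun x =>
    key x ▸ hβ _ (Finset.mem_image_of_mem _ (Finset.mem_univ _))
  cases c with
  | true =>
    obtain ⟨f, hf, hfA⟩ := hF₁ a' β'
    have h1 := hl ⟨f, Finset.mem_union_left _ hf⟩
    simp only [key, decide_eq_true_eq] at h1
    exact hfA h1
  | false =>
    obtain ⟨f, hf, hfB⟩ := hF₂ a' β'
    have h1 := hl ⟨f, Finset.mem_union_right _ hf⟩
    simp only [key, decide_eq_false_iff_not] at h1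
    exact (hmem ⟨f, Finset.mem_union_right _ hf⟩).elim h1 hfB

/-- The filter of all sets whose complement is not a `J`-set. -/
def coJFilter : Filter ℕ+ where
  sets := {A | ¬ IsJSet Aᶜ}
  univ_sets := fun h => by
    obtain ⟨a, β, hβ⟩ := h ⟨{1}, Finset.singleton_nonempty _⟩
    exact hβ 1 (Finset.mem_singleton_self _) trivial
  sets_of_superset := fun hA h hB => hA (hB.mono (Set.compl_subset_compl.2 h))
  inter_sets := fun hA hB h => by
    rw [Set.compl_inter] at h
    exact h.of_union.elim hA hB

theorem mem_coJFilter {A : Set ℕ+} : A ∈ coJFilter ↔ ¬ IsJSet Aᶜ := Iff.rfl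

theorem mem_JUltrafilters_of_le {p : Ultrafilter ℕ+} (h : (p : Filter ℕ+) ≤ coJFilter) :
    p ∈ JUltrafilters := by
  intro A hA
  by_contra hJ
  have : Aᶜ ∈ p := h (mem_coJFilter.2 (by rwa [compl_compl]))
  exact (Ultrafilter.compl_mem_iff_notMem.1 this) hA

theorem isClosed_JUltrafilters : IsClosed JUltrafilters := by
  have : JUltrafilters = ⋂ (A : Set ℕ+) (_ : ¬ IsJSet A), {p : Ultrafilter ℕ+ | Aᶜ ∈ p} := by
    ext p
    simp only [JUltrafilters, Set.mem_ofPred_eq, Set.mem_iInter, Ultrafilter.compl_mem_iff_notMem]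
    exact forall_congr' fun A => not_imp_not.symm
  rw [this]
  exact isClosed_iInter fun A => isClosed_iInter fun _ => ultrafilter_isClosed_basic _

/-- A witness for the translate `-x + A` becomes one for `A` when `x` is added to the constant, so
`𝒥` is a left ideal. -/
theorem add_mem_JUltrafilters (p : Ultrafilter ℕ+) {q : Ultrafilter ℕ+}
    (hq : q ∈ JUltrafilters) : p + q ∈ JUltrafilters := by
  intro A hA F
  obtain ⟨x, hx⟩ := p.nonempty_of_mem ((mem_ultrafilter_add p q A).1 hA)
  obtain ⟨a, β, h⟩ := hq _ hx F
  exact ⟨x + a, β, fun f hf => by rw [add_assoc]; exact h f hf⟩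

/-! ### Trees of large sets -/

/-- `GoodList C [xₖ, …, x₁]` says that each `xⱼ` lies in the set `C [xⱼ₋₁, …, x₁]`. -/
inductive GoodList {S : Type*} (C : List S → Set S) : List S → Prop
  | nil : GoodList C []
  | cons {xs : List S} {y : S} : GoodList C xs → y ∈ C xs → GoodList C (y :: xs)

theorem GoodList.mono {S : Type*} {C D : List S → Set S} (h : ∀ xs, C xs ⊆ D xs) {xs : List S}
    (hx : GoodList C xs) : GoodList D xs := by
  induction hx with
  | nil => exact .nil
  | cons _ hy ih => exact ih.cons (h _ hy)

/-- The list of entries of a tuple, last entry first. -/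
def revList {S : Type*} : (k : ℕ) → (Fin k → S) → List S
  | 0, _ => []
  | k + 1, x => x (Fin.last k) :: revList k (Fin.init x)

/-- The tuple whose entries, last entry first, are given by a list. -/
def tupleOfRevList (k : ℕ) (xs : List ℕ+) : Fin k → ℕ+ := fun i => xs.getD (k - 1 - i) 1

theorem tupleOfRevList_succ (k : ℕ) (y : ℕ+) (xs : List ℕ+) :
    tupleOfRevList (k + 1) (y :: xs) =
      Fin.snoc (α := fun _ => ℕ+) (tupleOfRevList k xs) y := by
  funext i
  refine Fin.lastCases ?_ (fun i => ?_) i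
  · simp [tupleOfRevList]
  · rw [Fin.snoc_castSucc]
    have : k + 1 - 1 - (i.castSucc : ℕ) = (k - 1 - i) + 1 := by
      have := i.2
      simp only [Fin.val_castSucc]
      omega
    simp only [tupleOfRevList, this, List.getD_cons_succ]

theorem tupleOfRevList_revList (k : ℕ) (x : Fin k → ℕ+) :
    tupleOfRevList k (revList k x) = x := by
  induction k with
  | zero => exact funext fun i => i.elim0
  | succ k ih => rw [revList, tupleOfRevList_succ, ih, Fin.snoc_init_self]

theorem length_revList {S : Type*} (k : ℕ) (x : Fin k → S) : (revList k x).length = k := by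
  induction k with
  | zero => rfl
  | succ k ih => simp [revList, ih]

/-- Membership in a tensor power is witnessed by a tree of large sets. -/
theorem exists_tree_of_mem_tensor (p : Ultrafilter ℕ+) (m : ℕ) (A : Set (Fin m → ℕ+))
    (hA : A ∈ ultrafilterTensor m (fun _ => p)) :
    ∃ C : List ℕ+ → Set ℕ+, (∀ xs, GoodList C xs → C xs ∈ p) ∧
      ∀ xs, GoodList C xs → xs.length = m → tupleOfRevList m xs ∈ A := by
  induction m with
  | zero =>
    refine ⟨fun _ => Set.univ, fun _ _ => Filter.univ_mem, fun xs _ _ => ?_⟩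
    have h : A ∈ (pure Fin.elim0 : Ultrafilter (Fin 0 → ℕ+)) := hA
    rw [Ultrafilter.mem_pure] at h
    rwa [Subsingleton.elim (tupleOfRevList 0 xs) Fin.elim0]
  | succ m ih =>
    obtain ⟨C, hC, hCA⟩ := ih _ ((mem_ultrafilterTensor_succ m _ A).1 hA)
    -- Only nodes at depth `m` are cut down, to the fibre of `A` over the tuple read so far.
    let D : List ℕ+ → Set ℕ+ := fun xs => {y | y ∈ C xs ∧ (xs.length = m →
      Fin.snoc (α := fun _ => ℕ+) (tupleOfRevList m xs) y ∈ A)}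
    have hDC : ∀ {xs}, GoodList D xs → GoodList C xs := fun h => h.mono fun _ _ hy => hy.1
    refine ⟨D, fun xs hxs => ?_, fun xs hxs hl => ?_⟩
    · by_cases hl : xs.length = m
      · filter_upwards [hC xs (hDC hxs), hCA xs (hDC hxs) hl] with y h₁ h₂ using ⟨h₁, fun _ => h₂⟩
      · filter_upwards [hC xs (hDC hxs)] with y h₁ using ⟨h₁, fun h => absurd h hl⟩
    · cases hxs with
      | nil => simp at hl
      | cons _ hy =>
        rw [tupleOfRevList_succ]
        exact hy.2 (by simpa using hl)

/-- For an idempotent ultrafilter the sets of a tree of large sets may be shrunk so that they are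
stable under translation by any of their members. -/
theorem exists_stable_tree {p : Ultrafilter ℕ+} (hp : p + p = p) (C : List ℕ+ → Set ℕ+)
    (hC : ∀ xs, GoodList C xs → C xs ∈ p) :
    ∃ D : List ℕ+ → Set ℕ+, (∀ xs, D xs ⊆ C xs) ∧ (∀ xs, GoodList D xs → D xs ∈ p) ∧
      ∀ xs, GoodList D xs → ∀ y ∈ D xs, {z | y + z ∈ D xs} ∈ p := by
  have star : ∀ B ∈ p, {x | {y | x + y ∈ B} ∈ p} ∈ p := fun B hB =>
    (mem_ultrafilter_add p p B).1 (by rwa [hp])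
  -- The points whose translate of `C xs` is again large. Applying `star` to that translate gives
  -- stability.
  let D : List ℕ+ → Set ℕ+ := fun xs => {y | y ∈ C xs ∧ {z | y + z ∈ C xs} ∈ p}
  have hDC : ∀ xs, D xs ⊆ C xs := fun xs y hy => hy.1
  refine ⟨D, hDC, fun xs hxs => ?_, fun xs hxs y hy => ?_⟩
  · have := hC xs (hxs.mono hDC)
    filter_upwards [this, star _ this] with y h₁ h₂ using ⟨h₁, h₂⟩
  · filter_upwards [hy.2, star _ hy.2] with z h₁ h₂
    refine ⟨h₁, ?_⟩
    simpa only [add_assoc] using h₂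

/-! ### Recursive choice of `α` and `H` -/

/-- Well-founded recursion for a relation between a value and the preceding values. -/
theorem exists_of_wellFounded {T X : Type*} {r : T → T → Prop} (hr : WellFounded r)
    (P : (F : T) → ((G : T) → r G F → X) → X → Prop) (h : ∀ F φ, ∃ v, P F φ v) :
    ∃ Φ : T → X, ∀ F, P F (fun G _ => Φ G) (Φ F) := by
  choose g hg using h
  refine ⟨hr.fix g, fun F => ?_⟩
  have := hg F fun G _ => hr.fix g G
  rwa [← hr.fix_eq g F] at this

theorem PFin.finite_ssubset {X : Type*} (F : PFin X) : {G : PFin X | G.1 ⊂ F.1}.Finite :=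
  (F.1.powerset.finite_toSet.preimage Subtype.val_injective.injOn).subset
    fun _ hG => Finset.mem_coe.2 (Finset.mem_powerset.2 (subset_of_ssubset hG))

theorem PFin.wellFounded_ssubset (X : Type*) :
    WellFounded fun G F : PFin X => G.1 ⊂ F.1 :=
  InvImage.wf _ (IsWellFounded.wf (r := fun s t : Finset X => s ⊂ t))

/-- `α` and `H` together with the set `S F` of all pairs of completed block sums and sum of the
current block, for chains ending in `F`. -/
theorem exists_chain_functions {p : Ultrafilter ℕ+} (hJ : p ∈ JUltrafilters)
    (D : List ℕ+ → Set ℕ+) (hD : ∀ xs, GoodList D xs → D xs ∈ p)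
    (hstable : ∀ xs, GoodList D xs → ∀ y ∈ D xs, {z | y + z ∈ D xs} ∈ p) :
    ∃ (α : PFin (ℕ+ → ℕ+) → ℕ+) (H : PFin (ℕ+ → ℕ+) → PFin ℕ+)
      (S : PFin (ℕ+ → ℕ+) → Set (List ℕ+ × ℕ+)),
      (∀ F G : PFin (ℕ+ → ℕ+), F.1 ⊂ G.1 → (H F).Precedes (H G)) ∧
      (∀ F, ∀ s ∈ S F, GoodList D (s.2 :: s.1)) ∧
      (∀ F, ∀ f ∈ F.1, ([], α F + (H F).sum f) ∈ S F) ∧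
      ∀ G F : PFin (ℕ+ → ℕ+), G.1 ⊂ F.1 → ∀ f ∈ F.1, ∀ s ∈ S G,
        (s.2 :: s.1, α F + (H F).sum f) ∈ S F ∧ (s.1, s.2 + (α F + (H F).sum f)) ∈ S F := by
  let X := ℕ+ × PFin ℕ+ ×
    {S : Set (List ℕ+ × ℕ+) // S.Finite ∧ ∀ s ∈ S, GoodList D (s.2 :: s.1)}
  let P : (F : PFin (ℕ+ → ℕ+)) → ((G : PFin (ℕ+ → ℕ+)) → G.1 ⊂ F.1 → X) → X → Prop :=
    fun F φ v => (∀ G h, (φ G h).2.1.Precedes v.2.1) ∧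
      (∀ f ∈ F.1, ([], v.1 + v.2.1.sum f) ∈ v.2.2.1) ∧
      ∀ G h, ∀ f ∈ F.1, ∀ s ∈ (φ G h).2.2.1, (s.2 :: s.1, v.1 + v.2.1.sum f) ∈ v.2.2.1 ∧
        (s.1, s.2 + (v.1 + v.2.1.sum f)) ∈ v.2.2.1
  have hP : ∀ F φ, ∃ v, P F φ v := by
    intro F φ
    have hfin : Finite {G : PFin (ℕ+ → ℕ+) // G.1 ⊂ F.1} := (PFin.finite_ssubset F).to_subtype
    let U : Set (List ℕ+ × ℕ+) :=
      ⋃ G : {G : PFin (ℕ+ → ℕ+) // G.1 ⊂ F.1}, (φ G.1 G.2).2.2.1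
    have hU : U.Finite := Set.finite_iUnion fun G => (φ G.1 G.2).2.2.2.1
    have hUD : ∀ s ∈ U, GoodList D (s.2 :: s.1) := by
      intro s hs
      obtain ⟨G, hG⟩ := Set.mem_iUnion.1 hs
      exact (φ G.1 G.2).2.2.2.2 s hG
    have hb : (⋃ G : {G : PFin (ℕ+ → ℕ+) // G.1 ⊂ F.1},
        (((φ G.1 G.2).2.1.1 : Finset ℕ+) : Set ℕ+)).Finite :=
      Set.finite_iUnion fun G => Finset.finite_toSet _
    obtain ⟨N, hN⟩ := hb.bddAbove
    -- A new term must be able to start the first block, to open a new block after any `s ∈ U`, and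
    -- to enlarge the current block of `s`.
    have hB : D [] ∩ ⋂ s ∈ U, (D (s.2 :: s.1) ∩ {z | s.2 + z ∈ D s.1}) ∈ p := by
      refine Filter.inter_mem (hD _ .nil) ((Filter.biInter_mem hU).2 fun s hs => ?_)
      cases hUD s hs with
      | cons h₁ h₂ => exact Filter.inter_mem (hD _ (h₁.cons h₂)) (hstable _ h₁ _ h₂)
    obtain ⟨a, β, hβ, hβB⟩ := (hJ _ hB).exists_gt F N
    refine ⟨⟨a, β, ⋃ f ∈ F.1, (insert ([], a + β.sum f)
      ((fun s => (s.2 :: s.1, a + β.sum f)) '' U ∪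
        (fun s => (s.1, s.2 + (a + β.sum f))) '' U)), ?_, ?_⟩, ?_, ?_, ?_⟩
    · exact F.1.finite_toSet.biUnion fun f _ => ((hU.image _).union (hU.image _)).insert _
    · intro s hs
      simp only [Set.mem_iUnion] at hs
      obtain ⟨f, hf, hs⟩ := hs
      obtain ⟨hz, hz'⟩ := hβB f hf
      simp only [Set.mem_iInter] at hz'
      rcases hs with rfl | ⟨t, ht, rfl⟩ | ⟨t, ht, rfl⟩
      · exact GoodList.nil.cons hz
      · exact (hUD t ht).cons (hz' t ht).1
      · cases hUD t ht with
        | cons h₁ h₂ => exact h₁.cons (hz' t ht).2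
    · intro G h
      refine PFin.precedes_iff.2 fun x hx y hy => (hN ?_).trans_lt (hβ y hy)
      exact Set.mem_iUnion.2 ⟨⟨G, h⟩, hx⟩
    · intro f hf
      exact Set.mem_biUnion hf (Set.mem_insert _ _)
    · intro G h f hf s hs
      have hsU : s ∈ U := Set.mem_iUnion.2 ⟨⟨G, h⟩, hs⟩
      exact ⟨Set.mem_biUnion hf (Or.inr (Or.inl ⟨s, hsU, rfl⟩)),
        Set.mem_biUnion hf (Or.inr (Or.inr ⟨s, hsU, rfl⟩))⟩
  obtain ⟨Φ, hΦ⟩ := exists_of_wellFounded (PFin.wellFounded_ssubset (ℕ+ → ℕ+)) P hP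
  exact ⟨fun F => (Φ F).1, fun F => (Φ F).2.1, fun F => (Φ F).2.2.1,
    fun F G h => (hΦ G).1 F h, fun F => (Φ F).2.2.2.2, fun F => (hΦ F).2.1,
    fun G F h => (hΦ F).2.2 G h⟩

theorem PFin.strictMono_of_succ {X : Type*} {G : ℕ+ → PFin X}
    (h : ∀ i, (G i).1 ⊂ (G (i + 1)).1) {i j : ℕ+} (hij : i < j) : (G i).1 ⊂ (G j).1 := by
  induction j using PNat.recOn with
  | one => exact absurd hij (not_lt_of_ge one_le)
  | succ j ih =>
    rcases (PNat.lt_add_one_iff.1 hij).lt_or_eq with h' | rfl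
    · exact (ih h').trans (h j)
    · exact h i

/-- Adding up a block of elements of a chain. -/
theorem block_sum_mem {S : ℕ+ → Set (List ℕ+ × ℕ+)} {v : ℕ+ → ℕ+}
    (hS : ∀ i j, i < j → ∀ s ∈ S i, (s.1, s.2 + v j) ∈ S j) (xs : List ℕ+)
    (b : Finset ℕ+) (hb : b.Nonempty) (h : ∀ i ∈ b, (xs, v i) ∈ S i) :
    (xs, PFin.sum ⟨b, hb⟩ v) ∈ S (b.max' hb) := by
  induction b using Finset.induction_on_max with
  | empty => exact absurd hb Finset.not_nonempty_empty
  | insert a b hlt ih =>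
    have ha : a ∉ b := fun h => lt_irrefl _ (hlt a h)
    rcases b.eq_empty_or_nonempty with rfl | hb'
    · convert h a (Finset.mem_insert_self _ _)
      · simp
      · exact PNat.coe_injective (Finset.sum_singleton _ _)
    · have h₁ := ih hb' fun i hi => h i (Finset.mem_insert_of_mem hi)
      have h₂ := hS _ a (hlt _ (b.max'_mem hb')) _ h₁
      have hmax : (insert a b).max' hb = a := by
        refine le_antisymm (Finset.max'_le _ _ _ fun y hy => ?_)
          (Finset.le_max' _ _ (Finset.mem_insert_self _ _))
        rcases Finset.mem_insert.1 hy with rfl | hy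
        · exact le_rfl
        · exact (hlt y hy).le
      rw [hmax]
      convert h₂ using 2
      apply PNat.coe_injective
      rw [PNat.add_coe, PFin.coe_sum, PFin.coe_sum, Finset.sum_insert ha, add_comm]

/-- The sums over consecutive blocks form a good list, which can be continued. -/
theorem goodList_block_sums {D : List ℕ+ → Set ℕ+} {S : ℕ+ → Set (List ℕ+ × ℕ+)} {v : ℕ+ → ℕ+}
    (hgood : ∀ i, ∀ s ∈ S i, GoodList D (s.2 :: s.1)) (hnil : ∀ i, ([], v i) ∈ S i)
    (hS : ∀ i j, i < j → ∀ s ∈ S i, (s.2 :: s.1, v j) ∈ S j ∧ (s.1, s.2 + v j) ∈ S j)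
    (k : ℕ) (β : Fin k → PFin ℕ+) (hβ : ∀ i j, i < j → (β i).Precedes (β j)) :
    GoodList D (revList k fun j => (β j).sum v) ∧
      ∀ i, (∀ j, ∀ t ∈ (β j).1, t < i) → (revList k (fun j => (β j).sum v), v i) ∈ S i := by
  induction k with
  | zero => exact ⟨.nil, fun i _ => hnil i⟩
  | succ k ih =>
    obtain ⟨-, h⟩ := ih (fun j => β j.castSucc) fun i j hij =>
      hβ _ _ (Fin.castSucc_lt_castSucc_iff.2 hij)
    -- The earlier sums can be continued by any term beyond their blocks, hence by every term of the
    -- last block.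
    have hmem := block_sum_mem (fun i j hij s hs => (hS i j hij s hs).2) _ _ (β (Fin.last k)).2
      fun i hi => h i fun j t ht =>
        PFin.precedes_iff.1 (hβ _ _ (Fin.castSucc_lt_last j)) t ht i hi
    exact ⟨hgood _ _ hmem, fun i hi =>
      (hS _ i (hi _ _ (Finset.max'_mem _ _)) _ hmem).1⟩

/-- A set that is large for a tensor power of an idempotent in `𝒥` contains all block sums along
chains, for suitable functions `α` and `H`. -/
theorem exists_functions_of_mem_tensor {p : Ultrafilter ℕ+} (hJ : p ∈ JUltrafilters)
    (hp : p + p = p) {m : ℕ} {A : Set (Fin m → ℕ+)}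
    (hA : A ∈ ultrafilterTensor m (fun _ => p)) :
    ∃ (α : PFin (ℕ+ → ℕ+) → ℕ+) (H : PFin (ℕ+ → ℕ+) → PFin ℕ+),
      (∀ F G : PFin (ℕ+ → ℕ+), F.1 ⊂ G.1 → (H F).Precedes (H G)) ∧
      (∀ G : ℕ+ → PFin (ℕ+ → ℕ+), (∀ i, (G i).1 ⊂ (G (i + 1)).1) →
        ∀ β : Fin m → PFin ℕ+, (∀ j k, j < k → (β j).Precedes (β k)) →
          ∀ f : ℕ+ → (ℕ+ → ℕ+), (∀ i, f i ∈ (G i).1) →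
            (fun j => (β j).sum fun i => α (G i) + (H (G i)).sum (f i)) ∈ A) := by
  obtain ⟨C, hC, hCA⟩ := exists_tree_of_mem_tensor p m A hA
  obtain ⟨D, hDC, hD, hstable⟩ := exists_stable_tree hp C hC
  obtain ⟨α, H, S, hH, hgood, hnil, hS⟩ := exists_chain_functions hJ D hD hstable
  refine ⟨α, H, hH, fun G hG β hβ f hf => ?_⟩
  have h := (goodList_block_sums (D := D) (S := fun i => S (G i)) (fun i => hgood (G i))
    (fun i => hnil (G i) (f i) (hf i))
    (fun i j hij => hS _ _ (PFin.strictMono_of_succ hG hij) (f j) (hf j)) m β hβ).1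
  rw [← tupleOfRevList_revList m fun j => (β j).sum _]
  exact hCA _ (h.mono hDC) (length_revList _ _)

/-! ### Sums along finite chains -/

section Chains

variable {T : Type*}

/-- `ChainSum v F x G` says that `x` is the sum of terms `v Gᵢ fᵢ` with `fᵢ ∈ Gᵢ` along a nonempty
strictly increasing chain of sets `Gᵢ` above `F` that ends in `G`. -/
inductive ChainSum (v : PFin T → T → ℕ+) (F : PFin T) : ℕ+ → PFin T → Prop
  | single {G : PFin T} {f : T} : F.1 ⊂ G.1 → f ∈ G.1 → ChainSum v F (v G f) G
  | step {x : ℕ+} {G K : PFin T} {f : T} :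
      ChainSum v F x G → G.1 ⊂ K.1 → f ∈ K.1 → ChainSum v F (x + v K f) K

theorem ChainSum.trans {v : PFin T → T → ℕ+} {F G K : PFin T} {x y : ℕ+}
    (hx : ChainSum v F x G) (hy : ChainSum v G y K) : ChainSum v F (x + y) K := by
  induction hy with
  | single h hf => exact hx.step h hf
  | step _ h hf ih => rw [← add_assoc]; exact ih.step h hf

theorem ChainSum.mono {v : PFin T → T → ℕ+} {F F' G : PFin T} {x : ℕ+} (h : F'.1 ⊆ F.1)
    (hx : ChainSum v F x G) : ChainSum v F' x G := by
  induction hx with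
  | single h' hf => exact .single (h.trans_ssubset h') hf
  | step _ h' hf ih => exact ih.step h' hf

/-- The set of all sums along finite chains above `F`. -/
def chainSums (v : PFin T → T → ℕ+) (F : PFin T) : Set ℕ+ := {x | ∃ G, ChainSum v F x G}

theorem chainSums_anti {v : PFin T → T → ℕ+} {F F' : PFin T} (h : F'.1 ⊆ F.1) :
    chainSums v F ⊆ chainSums v F' := fun _ ⟨G, hG⟩ => ⟨G, hG.mono h⟩

theorem PFin.exists_ssubset [Infinite T] (F : PFin T) : ∃ G : PFin T, F.1 ⊂ G.1 := by
  classical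
  obtain ⟨t, ht⟩ := Infinite.exists_notMem_finset F.1
  exact ⟨⟨insert t F.1, Finset.insert_nonempty _ _⟩, Finset.ssubset_insert ht⟩

/-- Given a chain sum `x` ending in `G`, the set `chainSums v G` lies in `q`, and chains above `G`
can be appended. -/
theorem chainSums_add_mem (v : PFin T → T → ℕ+) {p q : Ultrafilter ℕ+}
    (hp : ∀ F, chainSums v F ∈ p) (hq : ∀ F, chainSums v F ∈ q) (F : PFin T) :
    chainSums v F ∈ p + q := by
  rw [mem_ultrafilter_add]
  filter_upwards [hp F] with x ⟨G, hG⟩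
  filter_upwards [hq G] with y ⟨K, hK⟩ using ⟨K, hG.trans hK⟩

/-- `G` and `f` describe a strictly increasing chain with chosen members up to the index `n`. -/
def IsChainUpTo (n : ℕ+) (G : ℕ+ → PFin T) (f : ℕ+ → T) : Prop :=
  (∀ i < n, (G i).1 ⊂ (G (i + 1)).1) ∧ ∀ i ≤ n, f i ∈ (G i).1

theorem IsChainUpTo.exists_extend {n : ℕ+} {G : ℕ+ → PFin T} {f : ℕ+ → T}
    (h : IsChainUpTo n G f) {K : PFin T} (hK : (G n).1 ⊂ K.1) {g : T} (hg : g ∈ K.1) :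
    ∃ G' f', IsChainUpTo (n + 1) G' f' ∧ G' (n + 1) = K ∧ f' (n + 1) = g ∧
      ∀ i ≤ n, G' i = G i ∧ f' i = f i := by
  classical
  have hne : ∀ i ≤ n, i ≠ n + 1 := fun i hi => (PNat.lt_add_one_iff.2 hi).ne
  have hG : ∀ i ≤ n, Function.update G (n + 1) K i = G i := fun i hi =>
    Function.update_of_ne (hne i hi) _ _
  have hf : ∀ i ≤ n, Function.update f (n + 1) g i = f i := fun i hi =>
    Function.update_of_ne (hne i hi) _ _
  refine ⟨Function.update G (n + 1) K, Function.update f (n + 1) g, ⟨fun i hi => ?_,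
    fun i hi => ?_⟩, Function.update_self .., Function.update_self .., fun i hi =>
      ⟨hG i hi, hf i hi⟩⟩
  · have hi := PNat.lt_add_one_iff.1 hi
    rw [hG i hi]
    rcases hi.lt_or_eq with h' | rfl
    · rw [hG _ (PNat.add_one_le_iff.2 h')]
      exact h.1 i h'
    · rwa [Function.update_self]
  · rcases hi.lt_or_eq with h' | rfl
    · have h' := PNat.lt_add_one_iff.1 h'
      rw [hG i h', hf i h']
      exact h.2 i h'
    · rwa [Function.update_self, Function.update_self]

/-- Statement (1) speaks of infinite chains, whereas chain sums come from finite ones; enlarging the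
last set repeatedly bridges the gap. -/
theorem IsChainUpTo.exists_infinite [Infinite T] {n : ℕ+} {G : ℕ+ → PFin T} {f : ℕ+ → T}
    (h : IsChainUpTo n G f) :
    ∃ (G' : ℕ+ → PFin T) (f' : ℕ+ → T), (∀ i, (G' i).1 ⊂ (G' (i + 1)).1) ∧
      (∀ i, f' i ∈ (G' i).1) ∧ ∀ i ≤ n, G' i = G i ∧ f' i = f i := by
  classical
  choose s hs using PFin.exists_ssubset (T := T)
  choose e he using fun F : PFin T => F.2
  let G' : ℕ+ → PFin T := fun i => if i ≤ n then G i else s^[(i : ℕ) - n] (G n)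
  have hG' : ∀ i ≤ n, G' i = G i := fun i hi => if_pos hi
  have hG'' : ∀ i, n ≤ i → G' i = s^[(i : ℕ) - n] (G n) := by
    intro i hi
    rcases hi.lt_or_eq with h' | rfl
    · exact if_neg h'.not_ge
    · simp [G']
  refine ⟨G', fun i => if i ≤ n then f i else e (G' i), fun i => ?_, fun i => ?_,
    fun i hi => ⟨hG' i hi, if_pos hi⟩⟩
  · rcases lt_or_ge i n with hi | hi
    · rw [hG' i hi.le, hG' _ (PNat.add_one_le_iff.2 hi)]
      exact h.1 i hi
    · have : ((i + 1 : ℕ+) : ℕ) - n = ((i : ℕ) - n) + 1 := by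
        have : (n : ℕ) ≤ i := hi
        rw [PNat.add_coe, PNat.one_coe]
        omega
      rw [hG'' i hi, hG'' _ (hi.trans (PNat.lt_add_right i 1).le), this,
        Function.iterate_succ_apply']
      exact hs _
  · by_cases hi : i ≤ n
    · simp only [hi, if_true, hG' i hi]
      exact h.2 i hi
    · simp only [hi, if_false]
      exact he _

/-- The entries of `x` are block sums, over consecutive blocks, along a finite chain that ends
in `K`. -/
def IsBlockSums (v : PFin T → T → ℕ+) (k : ℕ) (x : Fin k → ℕ+) (K : PFin T) : Prop :=
  ∃ (n : ℕ+) (G : ℕ+ → PFin T) (f : ℕ+ → T) (β : Fin k → PFin ℕ+),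
    IsChainUpTo n G f ∧ G n = K ∧ (∀ i j, i < j → (β i).Precedes (β j)) ∧
      (∀ j, ∀ t ∈ (β j).1, t ≤ n) ∧ ∀ j, x j = (β j).sum fun i => v (G i) (f i)

theorem PFin.sum_congr {ι : Type*} (s : PFin ι) {f g : ι → ℕ+} (h : ∀ i ∈ s.1, f i = g i) :
    s.sum f = s.sum g :=
  PNat.coe_injective (Finset.sum_congr rfl fun i hi => by rw [h i hi])

theorem IsBlockSums.new_block {v : PFin T → T → ℕ+} {k : ℕ} {x : Fin k → ℕ+} {F K : PFin T}
    (h : IsBlockSums v k x F) (hK : F.1 ⊂ K.1) {g : T} (hg : g ∈ K.1) :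
    IsBlockSums v (k + 1) (Fin.snoc (α := fun _ => ℕ+) x (v K g)) K := by
  obtain ⟨n, G, f, β, hc, rfl, hβ, hβn, hx⟩ := h
  obtain ⟨G', f', hc', hG', hf', heq⟩ := hc.exists_extend hK hg
  refine ⟨n + 1, G', f', Fin.snoc (α := fun _ => PFin ℕ+) β
    ⟨{n + 1}, Finset.singleton_nonempty _⟩, hc', hG', ?_, ?_, ?_⟩
  · intro i j hij
    induction j using Fin.lastCases with
    | last =>
      induction i using Fin.lastCases with
      | last => exact absurd hij (lt_irrefl _)
      | cast i =>
        rw [Fin.snoc_castSucc, Fin.snoc_last]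
        refine PFin.precedes_iff.2 fun a ha b hb => ?_
        rw [Finset.mem_singleton.1 hb]
        exact PNat.lt_add_one_iff.2 (hβn i a ha)
    | cast j =>
      induction i using Fin.lastCases with
      | last => exact absurd hij (Fin.castSucc_lt_last j).not_gt
      | cast i =>
        rw [Fin.snoc_castSucc, Fin.snoc_castSucc]
        exact hβ i j (Fin.castSucc_lt_castSucc_iff.1 hij)
  · intro j
    induction j using Fin.lastCases with
    | last =>
      rw [Fin.snoc_last]
      intro t ht
      exact (Finset.mem_singleton.1 ht).le
    | cast j =>
      rw [Fin.snoc_castSucc]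
      exact fun t ht => (hβn j t ht).trans (PNat.lt_add_right n 1).le
  · intro j
    induction j using Fin.lastCases with
    | last =>
      rw [Fin.snoc_last, Fin.snoc_last]
      apply PNat.coe_injective
      simp [PFin.coe_sum, hG', hf']
    | cast j =>
      rw [Fin.snoc_castSucc, Fin.snoc_castSucc, hx j]
      refine PFin.sum_congr _ fun i hi => ?_
      rw [(heq i (hβn j i hi)).1, (heq i (hβn j i hi)).2]

theorem IsBlockSums.enlarge_block {v : PFin T → T → ℕ+} {k : ℕ} {x : Fin k → ℕ+} {y : ℕ+}
    {F K : PFin T} (h : IsBlockSums v (k + 1) (Fin.snoc (α := fun _ => ℕ+) x y) F)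
    (hK : F.1 ⊂ K.1) {g : T} (hg : g ∈ K.1) :
    IsBlockSums v (k + 1) (Fin.snoc (α := fun _ => ℕ+) x (y + v K g)) K := by
  classical
  obtain ⟨n, G, f, β, hc, rfl, hβ, hβn, hx⟩ := h
  obtain ⟨G', f', hc', hG', hf', heq⟩ := hc.exists_extend hK hg
  have hnot : n + 1 ∉ (β (Fin.last k)).1 := fun h =>
    (PNat.lt_add_right n 1).not_ge (hβn _ _ h)
  refine ⟨n + 1, G', f', Fin.snoc (α := fun _ => PFin ℕ+) (fun j => β j.castSucc)
    ⟨insert (n + 1) (β (Fin.last k)).1, Finset.insert_nonempty _ _⟩, hc', hG', ?_, ?_, ?_⟩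
  · intro i j hij
    induction j using Fin.lastCases with
    | last =>
      induction i using Fin.lastCases with
      | last => exact absurd hij (lt_irrefl _)
      | cast i =>
        rw [Fin.snoc_castSucc, Fin.snoc_last]
        refine PFin.precedes_iff.2 fun a ha b hb => ?_
        rcases Finset.mem_insert.1 hb with rfl | hb
        · exact PNat.lt_add_one_iff.2 (hβn _ a ha)
        · exact PFin.precedes_iff.1 (hβ _ _ hij) a ha b hb
    | cast j =>
      induction i using Fin.lastCases with
      | last => exact absurd hij (Fin.castSucc_lt_last j).not_gt
      | cast i =>
        rw [Fin.snoc_castSucc, Fin.snoc_castSucc]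
        exact hβ _ _ hij
  · intro j
    induction j using Fin.lastCases with
    | last =>
      rw [Fin.snoc_last]
      intro t ht
      rcases Finset.mem_insert.1 ht with rfl | ht
      · exact le_rfl
      · exact (hβn _ t ht).trans (PNat.lt_add_right n 1).le
    | cast j =>
      rw [Fin.snoc_castSucc]
      exact fun t ht => (hβn _ t ht).trans (PNat.lt_add_right n 1).le
  · intro j
    induction j using Fin.lastCases with
    | last =>
      have hy := hx (Fin.last k)
      rw [Fin.snoc_last] at hy
      rw [Fin.snoc_last, Fin.snoc_last, hy]
      apply PNat.coe_injective
      rw [PNat.add_coe, PFin.coe_sum, PFin.coe_sum, Finset.sum_insert hnot, add_comm, hG', hf']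
      congr 1
      refine Finset.sum_congr rfl fun i hi => ?_
      rw [(heq i (hβn _ i hi)).1, (heq i (hβn _ i hi)).2]
    | cast j =>
      have hj := hx j.castSucc
      rw [Fin.snoc_castSucc] at hj
      rw [Fin.snoc_castSucc, Fin.snoc_castSucc, hj]
      refine PFin.sum_congr _ fun i hi => ?_
      rw [(heq i (hβn _ i hi)).1, (heq i (hβn _ i hi)).2]

/-- The first term of the chain sum opens a new block and each later term enlarges it. -/
theorem IsBlockSums.snoc {v : PFin T → T → ℕ+} {k : ℕ} {x : Fin k → ℕ+} {y : ℕ+}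
    {F K : PFin T} (h : IsBlockSums v k x F) (hy : ChainSum v F y K) :
    IsBlockSums v (k + 1) (Fin.snoc (α := fun _ => ℕ+) x y) K := by
  induction hy with
  | single hK hg => exact h.new_block hK hg
  | step _ hK hg ih => exact ih.enlarge_block hK hg

theorem isBlockSums_mem_tensor [Nonempty T] {v : PFin T → T → ℕ+} {p : Ultrafilter ℕ+}
    (hp : ∀ F, chainSums v F ∈ p) (k : ℕ) :
    {x | ∃ K, IsBlockSums v k x K} ∈ ultrafilterTensor k (fun _ => p) := by
  induction k with
  | zero =>
    let t : T := Classical.arbitrary T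
    let F : PFin T := ⟨{t}, Finset.singleton_nonempty _⟩
    change _ ∈ (pure Fin.elim0 : Ultrafilter (Fin 0 → ℕ+))
    rw [Ultrafilter.mem_pure]
    exact ⟨F, 1, fun _ => F, fun _ => t, Fin.elim0,
      ⟨fun i hi => absurd hi (not_lt_of_ge one_le), fun _ _ => Finset.mem_singleton_self t⟩, rfl,
      fun i => i.elim0, fun i => i.elim0, fun i => i.elim0⟩
  | succ k ih =>
    rw [mem_ultrafilterTensor_succ]
    filter_upwards [ih] with x ⟨F, hF⟩
    filter_upwards [hp F] with y ⟨K, hK⟩ using ⟨K, hF.snoc hK⟩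

end Chains

-- The idempotent and the equivalence

attribute [local instance] Ultrafilter.addSemigroup in
/-- There is an idempotent in `𝒥` that contains all sets of chain sums. -/
theorem exists_idempotent_chainSums_mem (α : PFin (ℕ+ → ℕ+) → ℕ+)
    (H : PFin (ℕ+ → ℕ+) → PFin ℕ+) :
    ∃ p : Ultrafilter ℕ+, p ∈ JUltrafilters ∧ p + p = p ∧
      ∀ F, chainSums (fun F f => α F + (H F).sum f) F ∈ p := by
  classical
  let v : PFin (ℕ+ → ℕ+) → (ℕ+ → ℕ+) → ℕ+ := fun F f => α F + (H F).sum f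
  have hJ : ∀ F, IsJSet (chainSums v F) := by
    intro F E
    -- A chain with the single set `G` suffices: it lies above `F` and contains every sequence of
    -- `E`.
    obtain ⟨G, hG⟩ := PFin.exists_ssubset (⟨F.1 ∪ E.1, F.2.inl⟩ : PFin (ℕ+ → ℕ+))
    exact ⟨α G, H G, fun f hf => ⟨G, .single (Finset.subset_union_left.trans_ssubset hG)
      (hG.1 (Finset.mem_union_right _ hf))⟩⟩
  let Q : Set (Ultrafilter ℕ+) := JUltrafilters ∩ ⋂ F, {p | chainSums v F ∈ p}
  have hclosed : IsClosed Q :=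
    isClosed_JUltrafilters.inter (isClosed_iInter fun F => ultrafilter_isClosed_basic _)
  have hne : Q.Nonempty := by
    have : Nonempty (PFin (ℕ+ → ℕ+)) := ⟨⟨{1}, Finset.singleton_nonempty _⟩⟩
    -- The filters are directed because `chainSums` is antitone. Each is proper: a set of
    -- `coJFilter` missing `chainSums v F` would have a `J`-set as complement.
    have hbot : (⨅ F, coJFilter ⊓ Filter.principal (chainSums v F)).NeBot := by
      refine Filter.iInf_neBot_of_directed' (fun F G => ?_) fun F => ?_
      · refine ⟨⟨F.1 ∪ G.1, F.2.inl⟩, ?_, ?_⟩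
        · exact inf_le_inf_left _ (Filter.principal_mono.2
            (chainSums_anti Finset.subset_union_left))
        · exact inf_le_inf_left _ (Filter.principal_mono.2
            (chainSums_anti Finset.subset_union_right))
      · refine Filter.inf_principal_neBot_iff.2 fun U hU => ?_
        by_contra h
        rw [Set.not_nonempty_iff_eq_empty, Set.inter_comm, ← Set.disjoint_iff_inter_eq_empty,
          ← Set.subset_compl_iff_disjoint_right] at h
        exact mem_coJFilter.1 hU ((hJ F).mono h)
    have hle := Ultrafilter.of_le (⨅ F, coJFilter ⊓ Filter.principal (chainSums v F))
    refine ⟨Ultrafilter.of _, mem_JUltrafilters_of_le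
      (hle.trans ((iInf_le _ (Classical.arbitrary _)).trans inf_le_left)),
      Set.mem_iInter.2 fun F => ?_⟩
    exact Filter.le_principal_iff.1 (hle.trans ((iInf_le _ F).trans inf_le_right))
  obtain ⟨p, hpQ, hp⟩ := exists_idempotent_in_compact_add_subsemigroup
    Ultrafilter.continuous_add_left Q hne hclosed.isCompact fun p hp q hq =>
      ⟨add_mem_JUltrafilters p hq.1, Set.mem_iInter.2 fun F => chainSums_add_mem v
        (Set.mem_iInter.1 hp.2) (Set.mem_iInter.1 hq.2) F⟩
  exact ⟨p, hpQ.1, hp, Set.mem_iInter.1 hpQ.2⟩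

theorem corollary1p17 (m : ℕ) (hm : 1 ≤ m) (A : Set (Fin m → ℕ+)) :
    (∃ (α : PFin (ℕ+ → ℕ+) → ℕ+) (H : PFin (ℕ+ → ℕ+) → PFin ℕ+),
      (∀ F G : PFin (ℕ+ → ℕ+), F.1 ⊂ G.1 → (H F).Precedes (H G)) ∧
      (∀ G : ℕ+ → PFin (ℕ+ → ℕ+), (∀ i, (G i).1 ⊂ (G (i + 1)).1) →
        ∀ β : Fin m → PFin ℕ+, (∀ j k, j < k → (β j).Precedes (β k)) →
          ∀ f : ℕ+ → (ℕ+ → ℕ+), (∀ i, f i ∈ (G i).1) →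
            (fun j => (β j).sum fun i => α (G i) + (H (G i)).sum (f i)) ∈ A)) ↔
    ∃ p : Ultrafilter ℕ+, p ∈ JUltrafilters ∧ p + p = p ∧
      A ∈ ultrafilterTensor m (fun _ => p) := by

  constructor
  · rintro ⟨α, H, -, hA⟩
    obtain ⟨p, hJ, hp, hsums⟩ := exists_idempotent_chainSums_mem α H
    refine ⟨p, hJ, hp, ?_⟩
    filter_upwards [isBlockSums_mem_tensor hsums m] with x ⟨K, n, G, f, β, hc, _, hβ, hβn, hx⟩
    obtain ⟨G', f', hG', hf', heq⟩ := hc.exists_infinite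
    convert hA G' hG' β hβ f' hf'
    rw [hx]
    refine PFin.sum_congr _ fun i hi => ?_
    rw [(heq i (hβn _ i hi)).1, (heq i (hβn _ i hi)).2]
  · rintro ⟨p, hJ, hp, hA⟩
    exact exists_functions_of_mem_tensor hJ hp hA
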